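/- Let $d\ge 1$ be an integer, let $\nu,\mu>0$ be real, and let $\|\cdot\|$ be the Euclidean norm on $\mathbb{R}^d$. Let $T_1$ and $T_2$ be independent random vectors in $\mathbb{R}^d$ having Student $t$ distributions with $2\nu$ and $2\mu$ degrees of freedom respectively, i.e. with densities $f_\nu$ and $f_\mu$, where \[ f_{\nu}(x)=\frac{\Gamma(\nu+\frac d2)}{\Gamma(\nu)\,\pi^{d/2}}\,(1+\|x\|^2)^{-\nu-\frac d2},\qquad x\in\mathbb{R}^d . \] Let $B$ denote the Beta function and $(a)_n=a(a+1)\cdots(a+n-1)$ the rising factorial. For $n\ge 0$ and $\eta>0$ put \[ \phi_{n,\eta}(x)=\frac{\Gamma(\frac d2)}{\pi^{d/2}\,B(\eta,n+\frac d2)}\,\frac{\|x\|^{2n}}{(1+\|x\|^2)^{\eta+n+\frac d2}},\qquad x\in\mathbb{R}^d, \] \[ c_n^{(\nu,\mu)}=\frac{1}{B(\nu,\mu)}\,\frac{(\frac d2)_n}{n!}\int_0^1 t^{\mu+\frac d2-1}(1-t)^{\nu+\frac d2-1}(1-t+t^2)^n\,dt . \] Then every $\phi_{n,\nu+\mu}$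 is a probability density on $\mathbb{R}^d$, every $c_n^{(\nu,\mu)}$ is positive, $\sum_{n\ge 0}c_n^{(\nu,\mu)}=1$, and $T_1+T_2$ has the density \[ f_{T_1+T_2}(x)=\sum_{n=0}^{\infty}c_n^{(\nu,\mu)}\,\phi_{n,\nu+\mu}(x), \] where the series converges for every $x\in\mathbb{R}^d$. In particular, for $d=1$ and $\mu=\nu$ (Ruben's case), $T_1+T_2$ has the density \[ \sum_{n=0}^{\infty}\left(\frac{1}{B(\nu,\nu)}\,\frac{(\frac12)_n}{n!}\int_0^1 \bigl(t(1-t)\bigr)^{\nu-\frac12}(1-t+t^2)^n\,dt\right)\frac{1}{B(2\nu,n+\frac12)}\,\frac{x^{2n}}{(1+x^2)^{2\nu+n+\frac12}},\qquad x\in\mathbb{R}, \] where the series converges for every $x\in\mathbb{R}$. -/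

import Mathlib

open MeasureTheory ProbabilityTheory
open scoped Nat

noncomputable section

namespace StudentSum

/-- Density of the `d`-variate Student t distribution with `2 * ν` degrees of freedom:
`Γ(ν + d/2) / (Γ(ν) π^(d/2)) * (1 + ‖x‖²)^(-ν - d/2)`. -/
def studentDensity (d : ℕ) (ν : ℝ) (x : EuclideanSpace ℝ (Fin d)) : ℝ :=
  Real.Gamma (ν + d / 2) / (Real.Gamma ν * Real.pi ^ ((d : ℝ) / 2)) *
    (1 + ‖x‖ ^ 2) ^ (-ν - (d : ℝ) / 2)

/-- The `d`-variate Student t distribution with `2 * ν` degrees of freedom. -/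
def studentMeasure (d : ℕ) (ν : ℝ) : Measure (EuclideanSpace ℝ (Fin d)) :=
  volume.withDensity (fun x => ENNReal.ofReal (studentDensity d ν x))

/-- The function `φ_{n,η}` on `ℝ^d`:
`Γ(d/2) / (π^(d/2) B(η, n + d/2)) * ‖x‖^(2n) / (1 + ‖x‖²)^(η + n + d/2)`. -/
def phi (d n : ℕ) (η : ℝ) (x : EuclideanSpace ℝ (Fin d)) : ℝ :=
  Real.Gamma ((d : ℝ) / 2) / (Real.pi ^ ((d : ℝ) / 2) * beta η (n + (d : ℝ) / 2)) *
    (‖x‖ ^ (2 * n) / (1 + ‖x‖ ^ 2) ^ (η + n + (d : ℝ) / 2))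

/-- The coefficient `c_n^{(ν,μ)}` in dimension `d`; `(ascPochhammer ℝ n).eval a` is the
rising factorial `(a)_n = a (a + 1) ⋯ (a + n - 1)`. -/
def coeff (d : ℕ) (ν μ : ℝ) (n : ℕ) : ℝ :=
  1 / beta ν μ * ((ascPochhammer ℝ n).eval ((d : ℝ) / 2) / (n ! : ℝ)) *
    ∫ t in (0 : ℝ)..1,
      t ^ (μ + (d : ℝ) / 2 - 1) * (1 - t) ^ (ν + (d : ℝ) / 2 - 1) * (1 - t + t ^ 2) ^ n

end StudentSum

end

namespace StudentSum

open Set Real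

/-! A Student density is a gamma mixture of Gaussians, because `(1 + ‖x‖²)^(-a)` is `1/Γ(a)` times
the integral of `s^(a-1) exp(-s(1 + ‖x‖²))` over `s > 0`. Convolving two such mixtures convolves
Gaussians with parameters `s` and `r`. After the substitution `s = w(1-t)`, `r = wt`, the
`w`-integral is again a gamma integral, and the density of the sum becomes a beta-type integral over
`t` of `(1 + ‖x‖² t(1-t))^(-(ν+μ+d/2))` (`lconvolution_studentDensity`).

With `z = ‖x‖²/(1 + ‖x‖²)` one has `1 + ‖x‖² t(1-t) = (1 + ‖x‖²)(1 - z(1-t+t²))`. Expanding the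
second factor by the binomial series and integrating termwise
(`tsum_ofReal_ascPochhammer_mul_betaMoment`) gives the mixture, once the gamma factors are matched
(`coeff_mul_phi_eq`). The same expansion at `z = 1` with exponent `-d/2` shows that the coefficients
sum to one.

All integrands are nonnegative, so integrals are taken in `ENNReal` and Tonelli needs no
integrability. -/

/-! ### Gamma and Gaussian integrals. -/

lemma lintegral_ofReal_eq_of_integral_eq {α : Type*} [MeasurableSpace α] {m : Measure α}
    {f : α → ℝ} {c : ℝ} (h : ∫ x, f x ∂m = c) (hc : 0 < c) (hf : 0 ≤ᵐ[m] f) :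
    ∫⁻ x, ENNReal.ofReal (f x) ∂m = ENNReal.ofReal c := by
  -- A non-integrable function has Bochner integral `0` by convention, so a nonzero value forces
  -- integrability.
  have hi : Integrable f m := Integrable.of_integral_ne_zero (by rw [h]; exact hc.ne')
  rw [← ofReal_integral_eq_lintegral_ofReal hi hf, h]

lemma lintegral_rpow_mul_exp_neg_mul {a b : ℝ} (ha : 0 < a) (hb : 0 < b) :
    ∫⁻ s in Ioi (0 : ℝ), ENNReal.ofReal (s ^ (a - 1) * exp (-(b * s))) =
      ENNReal.ofReal (Gamma a * b ^ (-a)) := by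
  refine lintegral_ofReal_eq_of_integral_eq ?_ ?_ ?_
  · rw [integral_rpow_mul_exp_neg_mul_Ioi ha hb, one_div, inv_rpow hb.le, rpow_neg hb.le, mul_comm]
  · have := Gamma_pos_of_pos ha
    positivity
  · refine ae_restrict_of_forall_mem measurableSet_Ioi fun s hs => ?_
    have : (0 : ℝ) < s := hs
    positivity

lemma lintegral_norm_pow_mul_exp_neg_mul_sq {d : ℕ} (hd : 1 ≤ d) (n : ℕ) {b : ℝ} (hb : 0 < b) :
    ∫⁻ x : EuclideanSpace ℝ (Fin d), ENNReal.ofReal (‖x‖ ^ (2 * n) * exp (-(b * ‖x‖ ^ 2))) =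
      ENNReal.ofReal (π ^ ((d : ℝ) / 2) / Gamma ((d : ℝ) / 2) * Gamma (n + (d : ℝ) / 2) *
        b ^ (-(n + (d : ℝ) / 2))) := by
  have hd0 : (0 : ℝ) < d := by exact_mod_cast hd
  have : Nonempty (Fin d) := ⟨⟨0, hd⟩⟩
  have hg1 := Gamma_pos_of_pos (show 0 < (d : ℝ) / 2 by positivity)
  have hg2 := Gamma_pos_of_pos (show 0 < n + (d : ℝ) / 2 by positivity)
  refine lintegral_ofReal_eq_of_integral_eq ?_ (by positivity) (ae_of_all _ fun x => by positivity)
  -- Polar coordinates: the radial integral is multiplied by `d` times the volume of the unit ball,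
  -- and `Γ(d/2 + 1) = (d/2) Γ(d/2)` absorbs the factor `d/2`.
  rw [integral_fun_norm_addHaar volume (fun r => r ^ (2 * n) * exp (-(b * r ^ 2)))]
  have h1 : ∫ y in Ioi (0 : ℝ), y ^ (Module.finrank ℝ (EuclideanSpace ℝ (Fin d)) - 1) •
      (y ^ (2 * n) * exp (-(b * y ^ 2))) =
      ∫ y in Ioi (0 : ℝ), y ^ ((d : ℝ) - 1 + 2 * n) * exp (-b * y ^ (2 : ℝ)) := by
    refine setIntegral_congr_fun measurableSet_Ioi fun y hy => ?_
    have hy : 0 < y := hy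
    simp only [finrank_euclideanSpace, Fintype.card_fin, smul_eq_mul]
    rw [← mul_assoc, ← pow_add, ← rpow_natCast, Nat.cast_add, Nat.cast_sub hd]
    norm_num
  rw [h1, integral_rpow_mul_exp_neg_mul_rpow (by norm_num) (by
    have : (0 : ℝ) ≤ 2 * n := by positivity
    linarith) hb]
  simp only [Measure.real, EuclideanSpace.volume_ball, finrank_euclideanSpace, Fintype.card_fin,
    smul_eq_mul, nsmul_eq_mul, ENNReal.ofReal_one, one_pow, one_mul]
  have hg3 := Gamma_pos_of_pos (show 0 < (d : ℝ) / 2 + 1 by positivity)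
  rw [ENNReal.toReal_ofReal (by positivity), Gamma_add_one (by positivity)]
  have e1 : ((d : ℝ) - 1 + 2 * n + 1) / 2 = n + (d : ℝ) / 2 := by ring
  have e2 : -((d : ℝ) - 1 + 2 * n + 1) / 2 = -(n + (d : ℝ) / 2) := by ring
  have e3 : √π ^ d = π ^ ((d : ℝ) / 2) := by
    rw [sqrt_eq_rpow, ← rpow_natCast, ← rpow_mul pi_pos.le]
    congr 1; ring
  rw [e1, e2, e3]
  field_simp

lemma lintegral_exp_neg_mul_sq {d : ℕ} (hd : 1 ≤ d) {b : ℝ} (hb : 0 < b) :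
    ∫⁻ x : EuclideanSpace ℝ (Fin d), ENNReal.ofReal (exp (-(b * ‖x‖ ^ 2))) =
      ENNReal.ofReal (π ^ ((d : ℝ) / 2) * b ^ (-((d : ℝ) / 2))) := by
  have h := lintegral_norm_pow_mul_exp_neg_mul_sq hd 0 hb
  have hd0 : (0 : ℝ) < d := by exact_mod_cast hd
  have hg1 := Gamma_pos_of_pos (show 0 < (d : ℝ) / 2 by positivity)
  simpa [div_mul_cancel₀ _ hg1.ne'] using h

lemma ofReal_rpow_neg_eq_lintegral {a b : ℝ} (ha : 0 < a) (hb : 0 < b) :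
    ENNReal.ofReal (b ^ (-a)) = ENNReal.ofReal (Gamma a)⁻¹ *
      ∫⁻ s in Ioi (0 : ℝ), ENNReal.ofReal (s ^ (a - 1) * exp (-(b * s))) := by
  have hg := Gamma_pos_of_pos ha
  rw [lintegral_rpow_mul_exp_neg_mul ha hb, ← ENNReal.ofReal_mul (by positivity),
    inv_mul_cancel_left₀ hg.ne']

/-- Writing the denominator as a gamma integral makes the `x`-integral Gaussian. It yields `s^(-(n +
d/2))`, and what remains in `s` is the integral for `Γ(η)`. -/
lemma lintegral_phi {d : ℕ} (hd : 1 ≤ d) (n : ℕ) {η : ℝ} (hη : 0 < η) :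
    ∫⁻ x, ENNReal.ofReal (phi d n η x) = 1 := by
  have hd0 : (0 : ℝ) < d := by exact_mod_cast hd
  have hg1 := Gamma_pos_of_pos (show 0 < (d : ℝ) / 2 by positivity)
  have hg2 := Gamma_pos_of_pos (show 0 < n + (d : ℝ) / 2 by positivity)
  have hg3 := Gamma_pos_of_pos hη
  have ha : 0 < η + (n + (d : ℝ) / 2) := by positivity
  have hg4 := Gamma_pos_of_pos ha
  set a := η + (n + (d : ℝ) / 2) with hadef
  have hB := beta_pos hη (show 0 < n + (d : ℝ) / 2 by positivity)
  set C := Gamma ((d : ℝ) / 2) / (π ^ ((d : ℝ) / 2) * beta η (n + (d : ℝ) / 2)) with hC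
  have hCpos : 0 < C := by positivity
  have h1 : ∀ x, ENNReal.ofReal (phi d n η x) = ENNReal.ofReal (C * (Gamma a)⁻¹) *
      ∫⁻ s in Ioi (0 : ℝ), ENNReal.ofReal (s ^ (a - 1) * exp (-s)) *
        ENNReal.ofReal (‖x‖ ^ (2 * n) * exp (-(s * ‖x‖ ^ 2))) := by
    intro x
    have hb : 0 < 1 + ‖x‖ ^ 2 := by positivity
    have e1 : phi d n η x = C * ‖x‖ ^ (2 * n) * (1 + ‖x‖ ^ 2) ^ (-a) := by
      rw [phi, ← hC, rpow_neg hb.le, hadef, ← add_assoc]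
      ring
    rw [e1, ENNReal.ofReal_mul (by positivity), ofReal_rpow_neg_eq_lintegral ha hb, ← mul_assoc,
      ← ENNReal.ofReal_mul (by positivity), mul_right_comm, ENNReal.ofReal_mul (by positivity),
      mul_assoc, ← lintegral_const_mul' _ _ ENNReal.ofReal_ne_top]
    congr 1
    refine setLIntegral_congr_fun measurableSet_Ioi fun s hs => ?_
    have hs : 0 < s := hs
    rw [← ENNReal.ofReal_mul (by positivity), ← ENNReal.ofReal_mul (by positivity)]
    congr 1
    rw [show -((1 + ‖x‖ ^ 2) * s) = -s + -(s * ‖x‖ ^ 2) by ring, exp_add]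
    ring
  simp_rw [h1]
  rw [lintegral_const_mul' _ _ ENNReal.ofReal_ne_top, lintegral_lintegral_swap (by fun_prop)]
  have h2 : ∀ s ∈ Ioi (0 : ℝ), ∫⁻ x : EuclideanSpace ℝ (Fin d),
      ENNReal.ofReal (s ^ (a - 1) * exp (-s)) *
        ENNReal.ofReal (‖x‖ ^ (2 * n) * exp (-(s * ‖x‖ ^ 2))) =
      ENNReal.ofReal (π ^ ((d : ℝ) / 2) / Gamma ((d : ℝ) / 2) * Gamma (n + (d : ℝ) / 2)) *
        ENNReal.ofReal (s ^ (η - 1) * exp (-(1 * s))) := by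
    intro s hs
    have hs : 0 < s := hs
    rw [lintegral_const_mul' _ _ ENNReal.ofReal_ne_top,
      lintegral_norm_pow_mul_exp_neg_mul_sq hd n hs, ← ENNReal.ofReal_mul (by positivity),
      ← ENNReal.ofReal_mul (by positivity)]
    congr 1
    rw [show η - 1 = (a - 1) + -(n + (d : ℝ) / 2) by rw [hadef]; ring, rpow_add hs, one_mul]
    ring
  rw [setLIntegral_congr_fun measurableSet_Ioi h2, lintegral_const_mul' _ _ ENNReal.ofReal_ne_top,
    lintegral_rpow_mul_exp_neg_mul hη one_pos, one_rpow, mul_one,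
    ← ENNReal.ofReal_mul (by positivity), ← ENNReal.ofReal_mul (by positivity),
    ENNReal.ofReal_eq_one, hC, beta, ← hadef]
  have := rpow_pos_of_pos pi_pos ((d : ℝ) / 2)
  field_simp

/-! ### The convolution of two Student densities. -/

lemma lintegral_gaussian_mul_gaussian {d : ℕ} (hd : 1 ≤ d) {s r : ℝ} (hs : 0 < s) (hr : 0 < r)
    (x : EuclideanSpace ℝ (Fin d)) :
    ∫⁻ y : EuclideanSpace ℝ (Fin d), ENNReal.ofReal (exp (-(s * ‖y‖ ^ 2))) *
        ENNReal.ofReal (exp (-(r * ‖-y + x‖ ^ 2))) =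
      ENNReal.ofReal (π ^ ((d : ℝ) / 2) * (s + r) ^ (-((d : ℝ) / 2)) *
        exp (-(s * r / (s + r) * ‖x‖ ^ 2))) := by
  have hsr : 0 < s + r := by positivity
  -- Completing the square in `y` moves the centre to `(r/(s+r)) x`; translation invariance then
  -- removes it.
  have h1 : ∀ y : EuclideanSpace ℝ (Fin d), ENNReal.ofReal (exp (-(s * ‖y‖ ^ 2))) *
        ENNReal.ofReal (exp (-(r * ‖-y + x‖ ^ 2))) =
      ENNReal.ofReal (exp (-((s + r) * ‖y - (r / (s + r)) • x‖ ^ 2))) *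
        ENNReal.ofReal (exp (-(s * r / (s + r) * ‖x‖ ^ 2))) := by
    intro y
    rw [← ENNReal.ofReal_mul (by positivity), ← ENNReal.ofReal_mul (by positivity), ← exp_add,
      ← exp_add, neg_add_eq_sub y x, norm_sub_sq_real, norm_sub_sq_real, norm_smul, inner_smul_right,
      real_inner_comm, Real.norm_eq_abs, abs_of_pos (by positivity)]
    congr 2
    field_simp
    ring
  simp_rw [h1]
  rw [lintegral_mul_const' _ _ ENNReal.ofReal_ne_top,
    lintegral_sub_right_eq_self
      (fun y : EuclideanSpace ℝ (Fin d) => ENNReal.ofReal (exp (-((s + r) * ‖y‖ ^ 2)))),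
    lintegral_exp_neg_mul_sq hd hsr, ← ENNReal.ofReal_mul (by positivity)]

/-- The change of variables `(s, r) = (w (1 - t), w t)` on the open quadrant. -/
lemma lintegral_quadrant_eq {F : ℝ → ℝ → ENNReal} (hF : Measurable (Function.uncurry F)) :
    ∫⁻ s in Ioi (0 : ℝ), ∫⁻ r in Ioi (0 : ℝ), F s r =
      ∫⁻ t in Ioo (0 : ℝ) 1, ∫⁻ w in Ioi (0 : ℝ),
        ENNReal.ofReal w * F (w * (1 - t)) (w * t) := by
  have hm : ∀ {f g : ℝ × ℝ → ℝ}, Measurable f → Measurable g →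
      Measurable fun p => F (f p) (g p) := fun hf hg => hF.comp (hf.prodMk hg)
  rw [lintegral_lintegral_swap hF.aemeasurable]
  -- Two one-dimensional moves: the shift `w = s + r` at fixed `r`, then, after swapping, the
  -- scaling `r = w t` at fixed `w`, which supplies the Jacobian `w`.
  have h1 : ∀ r, ∫⁻ s in Ioi (0 : ℝ), F s r = ∫⁻ w, (Ioi r).indicator (fun w => F (w - r) r) w := by
    intro r
    rw [← lintegral_indicator measurableSet_Ioi,
      ← lintegral_sub_right_eq_self (fun s => (Ioi (0 : ℝ)).indicator (fun s => F s r) s) r]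
    refine lintegral_congr fun w => ?_
    simp [indicator, sub_pos]
  simp_rw [h1]
  have hset : MeasurableSet {p : ℝ × ℝ | p.1 < p.2} := measurableSet_lt measurable_fst measurable_snd
  have hmeas : Measurable (Function.uncurry fun r w : ℝ =>
      (Ioi r).indicator (fun w => F (w - r) r) w) := by
    have : (Function.uncurry fun r w : ℝ => (Ioi r).indicator (fun w => F (w - r) r) w) =
        {p : ℝ × ℝ | p.1 < p.2}.indicator (fun p => F (p.2 - p.1) p.1) := by
      ext ⟨r, w⟩
      simp [indicator]
    rw [this]
    exact (hm (by fun_prop) (by fun_prop)).indicator hset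
  rw [lintegral_lintegral_swap hmeas.aemeasurable]
  have h2 : ∀ w, ∫⁻ r in Ioi (0 : ℝ), (Ioi r).indicator (fun w => F (w - r) r) w =
      (Ioi (0 : ℝ)).indicator (fun w => ∫⁻ t in Ioo (0 : ℝ) 1,
        ENNReal.ofReal w * F (w * (1 - t)) (w * t)) w := by
    intro w
    have e1 : ∫⁻ r in Ioi (0 : ℝ), (Ioi r).indicator (fun w => F (w - r) r) w =
        ∫⁻ r in Ioo (0 : ℝ) w, F (w - r) r := by
      rw [← lintegral_indicator measurableSet_Ioi, ← lintegral_indicator measurableSet_Ioo]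
      refine lintegral_congr fun r => ?_
      by_cases h : 0 < r <;> by_cases h' : r < w <;> simp [indicator, h, h']
    rw [e1]
    by_cases hw : 0 < w
    · have him : (fun t => w * t) '' Ioo (0 : ℝ) 1 = Ioo 0 w := by
        rw [image_mul_left_Ioo hw, mul_zero, mul_one]
      rw [indicator_of_mem (show w ∈ Ioi (0 : ℝ) from hw), ← him,
        lintegral_image_eq_lintegral_abs_deriv_mul measurableSet_Ioo (f' := fun _ => w)
          (fun t _ => by simpa using ((hasDerivAt_id t).const_mul w).hasDerivWithinAt)
          (fun a _ b _ h => mul_left_cancel₀ hw.ne' h), abs_of_pos hw]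
      simp_rw [mul_sub, mul_one]
    · rw [indicator_of_notMem (show w ∉ Ioi (0 : ℝ) from hw), Ioo_eq_empty hw]
      simp
  simp_rw [h2]
  rw [lintegral_indicator measurableSet_Ioi, lintegral_lintegral_swap]
  refine Measurable.aemeasurable ?_
  exact (ENNReal.measurable_ofReal.comp measurable_fst).mul (hm (by fun_prop) (by fun_prop))

lemma ofReal_studentDensity {d : ℕ} {ν : ℝ} (hν : 0 < ν) (x : EuclideanSpace ℝ (Fin d)) :
    ENNReal.ofReal (studentDensity d ν x) = ENNReal.ofReal (Gamma ν * π ^ ((d : ℝ) / 2))⁻¹ *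
      ∫⁻ s in Ioi (0 : ℝ), ENNReal.ofReal (s ^ (ν + (d : ℝ) / 2 - 1) * exp (-s)) *
        ENNReal.ofReal (exp (-(s * ‖x‖ ^ 2))) := by
  have ha : 0 < ν + (d : ℝ) / 2 := by positivity
  have hb : 0 < 1 + ‖x‖ ^ 2 := by positivity
  have hg1 := Gamma_pos_of_pos ha
  have hg2 := Gamma_pos_of_pos hν
  rw [studentDensity, ← neg_add', ENNReal.ofReal_mul (by positivity),
    ofReal_rpow_neg_eq_lintegral ha hb, ← mul_assoc, ← ENNReal.ofReal_mul (by positivity)]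
  congr 1
  · congr 1
    field_simp
  refine setLIntegral_congr_fun measurableSet_Ioi fun s hs => ?_
  have hs : 0 < s := hs
  rw [← ENNReal.ofReal_mul (by positivity), mul_assoc, ← exp_add]
  ring_nf

lemma lconvolution_studentDensity {d : ℕ} (hd : 1 ≤ d) {ν μ : ℝ} (hν : 0 < ν) (hμ : 0 < μ)
    (x : EuclideanSpace ℝ (Fin d)) :
    ((fun y => ENNReal.ofReal (studentDensity d ν y)) ⋆ₗ[volume]
      fun y => ENNReal.ofReal (studentDensity d μ y)) x =
    ∫⁻ t in Ioo (0 : ℝ) 1, ENNReal.ofReal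
      (Gamma (ν + μ + (d : ℝ) / 2) / (Gamma ν * Gamma μ * π ^ ((d : ℝ) / 2)) *
        (t ^ (μ + (d : ℝ) / 2 - 1) * (1 - t) ^ (ν + (d : ℝ) / 2 - 1) *
          (1 + ‖x‖ ^ 2 * (t * (1 - t))) ^ (-(ν + μ + (d : ℝ) / 2)))) := by
  have hg1 := Gamma_pos_of_pos hν
  have hg2 := Gamma_pos_of_pos hμ
  have ha : 0 < ν + μ + (d : ℝ) / 2 := by positivity
  have hg3 := Gamma_pos_of_pos ha
  have hp := rpow_pos_of_pos pi_pos ((d : ℝ) / 2)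
  set p := (d : ℝ) / 2 with hpdef
  set A := (Gamma ν * π ^ p)⁻¹ * (Gamma μ * π ^ p)⁻¹ with hA
  have hA0 : 0 < A := by positivity
  let k : ℝ → ℝ → ENNReal := fun a s => ENNReal.ofReal (s ^ (a + p - 1) * exp (-s))
  have hk : ∀ a, Measurable (k a) := fun a => by fun_prop
  let G : ℝ → EuclideanSpace ℝ (Fin d) → ENNReal := fun s y => ENNReal.ofReal (exp (-(s * ‖y‖ ^ 2)))
  have hG : Measurable (Function.uncurry G) := by
    simp only [Function.uncurry_def, G]
    fun_prop
  have h1 : ∀ y, ENNReal.ofReal (studentDensity d ν y) * ENNReal.ofReal (studentDensity d μ (-y + x))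
      = ENNReal.ofReal A * ∫⁻ s in Ioi (0 : ℝ), ∫⁻ r in Ioi (0 : ℝ),
        (k ν s * G s y) * (k μ r * G r (-y + x)) := by
    intro y
    rw [lintegral_lintegral_mul, ofReal_studentDensity hν, ofReal_studentDensity hμ, hA,
      ENNReal.ofReal_mul (by positivity)]
    · ring
    · exact ((hk ν).mul (hG.comp (by fun_prop : Measurable fun s => (s, y)))).aemeasurable
    · exact ((hk μ).mul (hG.comp (by fun_prop : Measurable fun s => (s, -y + x)))).aemeasurable
  have hker : ∀ s ∈ Ioi (0 : ℝ), ∀ r ∈ Ioi (0 : ℝ),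
      ∫⁻ y, (k ν s * G s y) * (k μ r * G r (-y + x)) =
        ENNReal.ofReal (s ^ (ν + p - 1) * r ^ (μ + p - 1) * π ^ p * (s + r) ^ (-p) *
          exp (-((s + r) + s * r / (s + r) * ‖x‖ ^ 2))) := by
    intro s hs r hr
    have hs : 0 < s := hs
    have hr : 0 < r := hr
    simp_rw [mul_mul_mul_comm (k ν s)]
    rw [lintegral_const_mul' _ _ (by finiteness), lintegral_gaussian_mul_gaussian hd hs hr,
      ← ENNReal.ofReal_mul (by positivity), ← ENNReal.ofReal_mul (by positivity)]
    congr 1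
    rw [neg_add, neg_add, exp_add, exp_add]
    ring
  have hm3 : ∀ {f : (EuclideanSpace ℝ (Fin d) × ℝ) × ℝ → ℝ}
      {g : (EuclideanSpace ℝ (Fin d) × ℝ) × ℝ → EuclideanSpace ℝ (Fin d)},
      Measurable f → Measurable g → Measurable fun q => G (f q) (g q) :=
    fun hf hg => hG.comp (hf.prodMk hg)
  have hmeas : Measurable fun q : (EuclideanSpace ℝ (Fin d) × ℝ) × ℝ =>
      (k ν q.1.2 * G q.1.2 q.1.1) * (k μ q.2 * G q.2 (-q.1.1 + x)) :=
    (((hk ν).comp (by fun_prop)).mul (hm3 (by fun_prop) (by fun_prop))).mul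
      (((hk μ).comp (by fun_prop)).mul (hm3 (by fun_prop) (by fun_prop)))
  rw [lconvolution_def]
  simp_rw [h1]
  rw [lintegral_const_mul' _ _ ENNReal.ofReal_ne_top, lintegral_lintegral_swap]
  rotate_left
  · exact (hmeas.lintegral_prod_right' (ν := volume.restrict (Ioi (0 : ℝ)))).aemeasurable
  have h2 : ∀ s ∈ Ioi (0 : ℝ), ∫⁻ y, ∫⁻ r in Ioi (0 : ℝ),
      (k ν s * G s y) * (k μ r * G r (-y + x)) = ∫⁻ r in Ioi (0 : ℝ),
        ENNReal.ofReal (s ^ (ν + p - 1) * r ^ (μ + p - 1) * π ^ p * (s + r) ^ (-p) *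
          exp (-((s + r) + s * r / (s + r) * ‖x‖ ^ 2))) := by
    intro s hs
    rw [lintegral_lintegral_swap]
    · exact setLIntegral_congr_fun measurableSet_Ioi (hker s hs)
    · exact (hmeas.comp (by fun_prop :
        Measurable fun q : EuclideanSpace ℝ (Fin d) × ℝ => ((q.1, s), q.2))).aemeasurable
  rw [setLIntegral_congr_fun measurableSet_Ioi h2, lintegral_quadrant_eq (by
    simp only [Function.uncurry_def]
    fun_prop), ← lintegral_const_mul' _ _ ENNReal.ofReal_ne_top]
  refine setLIntegral_congr_fun measurableSet_Ioo fun t ht => ?_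
  have ht0 : 0 < t := ht.1
  have ht1 : 0 < 1 - t := sub_pos.2 ht.2
  have hb : 0 < 1 + ‖x‖ ^ 2 * (t * (1 - t)) := by positivity
  have h3 : ∀ w ∈ Ioi (0 : ℝ), ENNReal.ofReal w *
      ENNReal.ofReal ((w * (1 - t)) ^ (ν + p - 1) * (w * t) ^ (μ + p - 1) * π ^ p *
        (w * (1 - t) + w * t) ^ (-p) * exp (-((w * (1 - t) + w * t) +
          (w * (1 - t)) * (w * t) / (w * (1 - t) + w * t) * ‖x‖ ^ 2))) =
      ENNReal.ofReal (π ^ p * (t ^ (μ + p - 1) * (1 - t) ^ (ν + p - 1))) *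
        ENNReal.ofReal (w ^ (ν + μ + p - 1) *
          exp (-((1 + ‖x‖ ^ 2 * (t * (1 - t))) * w))) := by
    intro w hw
    have hw : 0 < w := hw
    have e1 : w * (1 - t) + w * t = w := by ring
    -- The lone factor `w` is the Jacobian, and `w^(-p)` comes from the Gaussian normalisation `(s +
    -- r)^(-p)`.
    have e2 : w ^ (ν + μ + p - 1) = w * w ^ (ν + p - 1) * w ^ (μ + p - 1) * w ^ (-p) := by
      nth_rewrite 2 [← rpow_one w]
      rw [← rpow_add hw, ← rpow_add hw, ← rpow_add hw]
      ring_nf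
    have e3 : w + w * (1 - t) * (w * t) / w * ‖x‖ ^ 2 = (1 + ‖x‖ ^ 2 * (t * (1 - t))) * w := by
      field_simp
    rw [e1, e3, ← ENNReal.ofReal_mul (by positivity), ← ENNReal.ofReal_mul (by positivity), e2,
      mul_rpow hw.le ht1.le, mul_rpow hw.le ht0.le]
    congr 1
    ring
  rw [setLIntegral_congr_fun measurableSet_Ioi h3, lintegral_const_mul' _ _ ENNReal.ofReal_ne_top,
    lintegral_rpow_mul_exp_neg_mul ha hb, ← ENNReal.ofReal_mul (by positivity),
    ← ENNReal.ofReal_mul (by positivity)]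
  congr 1
  rw [hA]
  field_simp

/-! ### The binomial series and beta-weighted moments. -/

lemma hasSum_ascPochhammer_mul_pow (a : ℝ) {y : ℝ} (hy0 : 0 ≤ y) (hy : y < 1) :
    HasSum (fun n : ℕ => (ascPochhammer ℝ n).eval a / (n ! : ℝ) * y ^ n) ((1 - y) ^ (-a)) := by
  have h := (one_div_one_sub_rpow_hasFPowerSeriesOnBall_zero a).hasSum (y := y) (by
    simpa [enorm_eq_nnnorm, abs_of_nonneg hy0, ← NNReal.coe_lt_coe] using hy)
  have e : ∀ n : ℕ, Ring.choose (a + n - 1) n = (ascPochhammer ℝ n).eval a / (n ! : ℝ) := by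
    intro n
    rw [← Ring.multichoose_eq, eq_div_iff (by positivity), mul_comm, ← nsmul_eq_mul,
      Ring.factorial_nsmul_multichoose_eq_ascPochhammer,
      Polynomial.ascPochhammer_smeval_eq_eval]
  simpa [e, rpow_neg (sub_pos.2 hy).le, mul_comm] using h

lemma Gamma_add_natCast_eq {a : ℝ} (ha : 0 < a) (n : ℕ) :
    Gamma (a + n) = (ascPochhammer ℝ n).eval a * Gamma a := by
  induction n with
  | zero => simp
  | succ n ih =>
    rw [Nat.cast_succ, ← add_assoc, Gamma_add_one (by positivity), ih, ascPochhammer_succ_eval]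
    ring

/-- This is the normalisation of the beta distribution, with the constant moved to the other side.
-/
lemma lintegral_rpow_mul_one_sub_rpow {p q : ℝ} (hp : 0 < p) (hq : 0 < q) :
    ∫⁻ t in Ioo (0 : ℝ) 1, ENNReal.ofReal (t ^ (p - 1) * (1 - t) ^ (q - 1)) =
      ENNReal.ofReal (beta p q) := by
  have hB := beta_pos hp hq
  have h := lintegral_betaPDF_eq_one hp hq
  rw [lintegral_betaPDF] at h
  simp_rw [mul_assoc, ENNReal.ofReal_mul (one_div_pos.2 hB).le] at h
  rw [lintegral_const_mul' _ _ ENNReal.ofReal_ne_top] at h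
  have h1 : ENNReal.ofReal (beta p q) * ENNReal.ofReal (1 / beta p q) = 1 := by
    rw [← ENNReal.ofReal_mul hB.le, mul_one_div_cancel hB.ne', ENNReal.ofReal_one]
  rw [← one_mul (∫⁻ _ in _, _), ← h1, mul_assoc, h, mul_one]

lemma one_sub_add_sq_mem {t : ℝ} (ht : t ∈ Ioo (0 : ℝ) 1) : 1 - t + t ^ 2 ∈ Ioo (0 : ℝ) 1 :=
  ⟨by nlinarith [ht.1, ht.2, sq_nonneg t], by nlinarith [mul_pos ht.1 (sub_pos.2 ht.2)]⟩

/-- The weighted moments `∫₀¹ t^(p-1) (1-t)^(q-1) (1-t+t²)^n dt`. -/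
noncomputable def betaMoment (p q : ℝ) (n : ℕ) : ℝ :=
  ∫ t in (0 : ℝ)..1, t ^ (p - 1) * (1 - t) ^ (q - 1) * (1 - t + t ^ 2) ^ n

lemma integrableOn_betaMoment {p q : ℝ} (hp : 0 < p) (hq : 0 < q) (n : ℕ) :
    IntegrableOn (fun t : ℝ => t ^ (p - 1) * (1 - t) ^ (q - 1) * (1 - t + t ^ 2) ^ n)
      (Ioo 0 1) := by
  have h0 : IntegrableOn (fun t : ℝ => t ^ (p - 1) * (1 - t) ^ (q - 1)) (Ioo 0 1) := by
    refine (lintegral_ofReal_ne_top_iff_integrable (by fun_prop) ?_).1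
      (by rw [lintegral_rpow_mul_one_sub_rpow hp hq]; exact ENNReal.ofReal_ne_top)
    refine ae_restrict_of_forall_mem measurableSet_Ioo fun t ht => ?_
    exact mul_nonneg (rpow_nonneg ht.1.le _) (rpow_nonneg (sub_pos.2 ht.2).le _)
  refine h0.mul_bdd (c := 1) (by fun_prop) ?_
  refine ae_restrict_of_forall_mem measurableSet_Ioo fun t ht => ?_
  have := one_sub_add_sq_mem ht
  rw [Real.norm_eq_abs, abs_of_nonneg (pow_nonneg this.1.le _)]
  exact pow_le_one₀ this.1.le this.2.le

lemma betaMoment_pos {p q : ℝ} (hp : 0 < p) (hq : 0 < q) (n : ℕ) : 0 < betaMoment p q n := by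
  refine intervalIntegral.intervalIntegral_pos_of_pos_on ?_ (fun t ht => ?_) one_pos
  · rw [intervalIntegrable_iff_integrableOn_Ioo_of_le zero_le_one]
    exact integrableOn_betaMoment hp hq n
  · have := (one_sub_add_sq_mem ht).1
    have := ht.1
    have := sub_pos.2 ht.2
    positivity

lemma ofReal_betaMoment {p q : ℝ} (hp : 0 < p) (hq : 0 < q) (n : ℕ) :
    ENNReal.ofReal (betaMoment p q n) = ∫⁻ t in Ioo (0 : ℝ) 1,
      ENNReal.ofReal (t ^ (p - 1) * (1 - t) ^ (q - 1) * (1 - t + t ^ 2) ^ n) := by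
  rw [betaMoment, intervalIntegral.integral_of_le zero_le_one, integral_Ioc_eq_integral_Ioo,
    ofReal_integral_eq_lintegral_ofReal (integrableOn_betaMoment hp hq n)]
  refine ae_restrict_of_forall_mem measurableSet_Ioo fun t ht => ?_
  have := (one_sub_add_sq_mem ht).1
  have := ht.1
  have := sub_pos.2 ht.2
  simp only [Pi.zero_apply]
  positivity

/-- Termwise integration of the binomial series. The endpoint `z = 1` is allowed because `1 - t + t²
< 1` on the open interval; it serves the sum of the coefficients, while `z = ‖x‖²/(1 + ‖x‖²)` serves
the density. -/
lemma tsum_ofReal_ascPochhammer_mul_betaMoment {p q a z : ℝ} (hp : 0 < p) (hq : 0 < q)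
    (ha : 0 < a) (hz0 : 0 ≤ z) (hz1 : z ≤ 1) :
    ∑' n : ℕ, ENNReal.ofReal
        ((ascPochhammer ℝ n).eval a / (n ! : ℝ) * z ^ n * betaMoment p q n) =
      ∫⁻ t in Ioo (0 : ℝ) 1, ENNReal.ofReal
        (t ^ (p - 1) * (1 - t) ^ (q - 1) * (1 - z * (1 - t + t ^ 2)) ^ (-a)) := by
  have hc : ∀ n : ℕ, 0 < (ascPochhammer ℝ n).eval a / (n ! : ℝ) := fun n =>
    div_pos (ascPochhammer_pos n a ha) (by positivity)
  have h1 : ∀ n : ℕ, ENNReal.ofReal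
      ((ascPochhammer ℝ n).eval a / (n ! : ℝ) * z ^ n * betaMoment p q n) =
      ∫⁻ t in Ioo (0 : ℝ) 1, ENNReal.ofReal ((ascPochhammer ℝ n).eval a / (n ! : ℝ) * z ^ n) *
        ENNReal.ofReal (t ^ (p - 1) * (1 - t) ^ (q - 1) * (1 - t + t ^ 2) ^ n) := by
    intro n
    rw [lintegral_const_mul' _ _ ENNReal.ofReal_ne_top, ← ofReal_betaMoment hp hq,
      ENNReal.ofReal_mul (mul_nonneg (hc n).le (by positivity))]
  simp_rw [h1]
  rw [← lintegral_tsum (fun n => by fun_prop)]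
  refine setLIntegral_congr_fun measurableSet_Ioo fun t ht => ?_
  obtain ⟨hq0, hq1⟩ := one_sub_add_sq_mem ht
  have ht0 := ht.1
  have ht1 := sub_pos.2 ht.2
  have hs := hasSum_ascPochhammer_mul_pow a (y := z * (1 - t + t ^ 2)) (by positivity)
    (lt_of_le_of_lt (mul_le_of_le_one_left hq0.le hz1) hq1)
  have hs := hs.mul_left (t ^ (p - 1) * (1 - t) ^ (q - 1))
  rw [← hs.tsum_eq, ENNReal.ofReal_tsum_of_nonneg (fun n => ?_) hs.summable]
  · refine tsum_congr fun n => ?_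
    rw [← ENNReal.ofReal_mul (mul_nonneg (hc n).le (by positivity)), mul_pow]
    congr 1
    ring
  · have := hc n
    positivity

lemma hasSum_of_tsum_ofReal_eq {f : ℕ → ℝ} {S : ℝ} (hf : ∀ n, 0 ≤ f n) (hS : 0 ≤ S)
    (h : ∑' n, ENNReal.ofReal (f n) = ENNReal.ofReal S) : HasSum f S := by
  have := ENNReal.hasSum_toReal (f := fun n => ENNReal.ofReal (f n))
    (by rw [h]; exact ENNReal.ofReal_ne_top)
  rw [← ENNReal.tsum_toReal_eq (fun _ => ENNReal.ofReal_ne_top), h, ENNReal.toReal_ofReal hS] at this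
  simpa only [ENNReal.toReal_ofReal (hf _)] using this

/-! ### The coefficients and the mixture series. -/

lemma coeff_eq (d : ℕ) (ν μ : ℝ) (n : ℕ) :
    coeff d ν μ n = 1 / beta ν μ * ((ascPochhammer ℝ n).eval ((d : ℝ) / 2) / (n ! : ℝ)) *
      betaMoment (μ + (d : ℝ) / 2) (ν + (d : ℝ) / 2) n := rfl

lemma coeff_pos {d : ℕ} (hd : 1 ≤ d) {ν μ : ℝ} (hν : 0 < ν) (hμ : 0 < μ) (n : ℕ) :
    0 < coeff d ν μ n := by
  have hd0 : (0 : ℝ) < d := by exact_mod_cast hd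
  have h1 := beta_pos hν hμ
  have h2 := ascPochhammer_pos n ((d : ℝ) / 2) (by positivity)
  have h3 := betaMoment_pos (p := μ + (d : ℝ) / 2) (q := ν + (d : ℝ) / 2) (by positivity)
    (by positivity) n
  rw [coeff_eq]
  positivity

/-- At `z = 1`, `a = d/2` the expanded factor is `(t(1-t))^(-d/2)`, which cancels the `d/2` in both
exponents and leaves the integral for `B(μ, ν)`. -/
lemma hasSum_coeff {d : ℕ} (hd : 1 ≤ d) {ν μ : ℝ} (hν : 0 < ν) (hμ : 0 < μ) :
    HasSum (fun n : ℕ => coeff d ν μ n) 1 := by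
  have hd0 : (0 : ℝ) < d := by exact_mod_cast hd
  have hB := beta_pos hν hμ
  have hp : 0 < μ + (d : ℝ) / 2 := by positivity
  have hq : 0 < ν + (d : ℝ) / 2 := by positivity
  have ha : 0 < (d : ℝ) / 2 := by positivity
  have h := tsum_ofReal_ascPochhammer_mul_betaMoment hp hq ha zero_le_one le_rfl
  have h1 : ∀ t ∈ Ioo (0 : ℝ) 1, ENNReal.ofReal (t ^ (μ + (d : ℝ) / 2 - 1) *
      (1 - t) ^ (ν + (d : ℝ) / 2 - 1) * (1 - 1 * (1 - t + t ^ 2)) ^ (-((d : ℝ) / 2))) =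
      ENNReal.ofReal (t ^ (μ - 1) * (1 - t) ^ (ν - 1)) := by
    intro t ht
    have ht1 := sub_pos.2 ht.2
    have ht0 := ht.1
    rw [show 1 - 1 * (1 - t + t ^ 2) = t * (1 - t) by ring, mul_rpow ht0.le ht1.le,
      mul_mul_mul_comm, ← rpow_add ht0, ← rpow_add ht1]
    ring_nf
  rw [setLIntegral_congr_fun measurableSet_Ioo h1, lintegral_rpow_mul_one_sub_rpow hμ hν] at h
  have hs := (hasSum_of_tsum_ofReal_eq (fun n => ?_) (beta_pos hμ hν).le h).mul_left
    (1 / beta ν μ)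
  · rw [show beta μ ν = beta ν μ by rw [beta, beta, mul_comm, add_comm],
      one_div_mul_cancel hB.ne'] at hs
    refine (funext fun n => ?_ : _ = fun n => coeff d ν μ n) ▸ hs
    rw [coeff_eq]
    ring
  · have := ascPochhammer_pos n _ ha
    have := betaMoment_pos hp hq n
    positivity

lemma measurable_phi (d n : ℕ) (η : ℝ) : Measurable (phi d n η) := by
  unfold phi
  fun_prop

lemma phi_nonneg {d : ℕ} (hd : 1 ≤ d) (n : ℕ) {η : ℝ} (hη : 0 < η)
    (x : EuclideanSpace ℝ (Fin d)) : 0 ≤ phi d n η x := by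
  have hd0 : (0 : ℝ) < d := by exact_mod_cast hd
  have hg := Gamma_pos_of_pos (show 0 < (d : ℝ) / 2 by positivity)
  have hB := beta_pos hη (show 0 < n + (d : ℝ) / 2 by positivity)
  unfold phi
  positivity

/-- `Γ(ν+μ)` cancels between the two beta functions, and `(d/2)_n Γ(d/2) = Γ(n + d/2)` cancels
inside the second. The surviving `Γ(ν+μ+d/2+n)` produces the rising factorial of the binomial series
with exponent `-(ν+μ+d/2)`. -/
lemma coeff_mul_phi_eq {d : ℕ} (hd : 1 ≤ d) {ν μ : ℝ} (hν : 0 < ν) (hμ : 0 < μ) (n : ℕ)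
    (x : EuclideanSpace ℝ (Fin d)) :
    coeff d ν μ n * phi d n (ν + μ) x =
      Gamma (ν + μ + (d : ℝ) / 2) / (Gamma ν * Gamma μ * π ^ ((d : ℝ) / 2)) *
        (1 + ‖x‖ ^ 2) ^ (-(ν + μ + (d : ℝ) / 2)) *
        ((ascPochhammer ℝ n).eval (ν + μ + (d : ℝ) / 2) / (n ! : ℝ) *
          (‖x‖ ^ 2 / (1 + ‖x‖ ^ 2)) ^ n * betaMoment (μ + (d : ℝ) / 2) (ν + (d : ℝ) / 2) n) := by
  have hd0 : (0 : ℝ) < d := by exact_mod_cast hd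
  have hX : 0 < 1 + ‖x‖ ^ 2 := by positivity
  have ha : 0 < ν + μ + (d : ℝ) / 2 := by positivity
  have hp : 0 < (d : ℝ) / 2 := by positivity
  have e1 := Gamma_add_natCast_eq ha n
  have e2 := Gamma_add_natCast_eq hp n
  have e3 : (1 + ‖x‖ ^ 2) ^ (ν + μ + n + (d : ℝ) / 2) =
      (1 + ‖x‖ ^ 2) ^ (ν + μ + (d : ℝ) / 2) * (1 + ‖x‖ ^ 2) ^ n := by
    rw [← rpow_natCast (1 + ‖x‖ ^ 2) n, ← rpow_add hX]
    ring_nf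
  have h1 := Gamma_pos_of_pos hν
  have h2 := Gamma_pos_of_pos hμ
  have h3 := Gamma_pos_of_pos (add_pos hν hμ)
  have h4 := Gamma_pos_of_pos ha
  have h5 := Gamma_pos_of_pos hp
  have h6 := ascPochhammer_pos n _ hp
  have h7 := ascPochhammer_pos n _ ha
  have h8 := rpow_pos_of_pos pi_pos ((d : ℝ) / 2)
  have h9 := rpow_pos_of_pos hX (ν + μ + (d : ℝ) / 2)
  rw [coeff_eq, phi, beta, beta, show ν + μ + (n + (d : ℝ) / 2) = ν + μ + (d : ℝ) / 2 + n by ring,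
    add_comm (n : ℝ) ((d : ℝ) / 2), e1, e2, e3, rpow_neg hX.le, pow_mul, div_pow]
  field_simp

lemma summable_coeff_mul_phi_and_lconvolution_eq {d : ℕ} (hd : 1 ≤ d) {ν μ : ℝ} (hν : 0 < ν) (hμ : 0 < μ)
    (x : EuclideanSpace ℝ (Fin d)) :
    Summable (fun n : ℕ => coeff d ν μ n * phi d n (ν + μ) x) ∧
    ((fun y => ENNReal.ofReal (studentDensity d ν y)) ⋆ₗ[volume]
      fun y => ENNReal.ofReal (studentDensity d μ y)) x =
    ENNReal.ofReal (∑' n : ℕ, coeff d ν μ n * phi d n (ν + μ) x) := by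
  have hd0 : (0 : ℝ) < d := by exact_mod_cast hd
  have hX : 0 < 1 + ‖x‖ ^ 2 := by positivity
  have ha : 0 < ν + μ + (d : ℝ) / 2 := by positivity
  have hp : 0 < μ + (d : ℝ) / 2 := by positivity
  have hq : 0 < ν + (d : ℝ) / 2 := by positivity
  have h1 := Gamma_pos_of_pos hν
  have h2 := Gamma_pos_of_pos hμ
  have h4 := Gamma_pos_of_pos ha
  have hz0 : 0 ≤ ‖x‖ ^ 2 / (1 + ‖x‖ ^ 2) := by positivity
  have hz1 : ‖x‖ ^ 2 / (1 + ‖x‖ ^ 2) ≤ 1 := by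
    rw [div_le_one hX]
    linarith
  have hnn : ∀ n : ℕ, 0 ≤ coeff d ν μ n * phi d n (ν + μ) x := fun n =>
    mul_nonneg (coeff_pos hd hν hμ n).le (phi_nonneg hd n (add_pos hν hμ) x)
  have hconv := lconvolution_studentDensity hd hν hμ x
  set K := Gamma (ν + μ + (d : ℝ) / 2) / (Gamma ν * Gamma μ * π ^ ((d : ℝ) / 2)) with hK
  have hK0 : 0 < K := by positivity
  have htsum : ∑' n : ℕ, ENNReal.ofReal (coeff d ν μ n * phi d n (ν + μ) x) =
      ((fun y => ENNReal.ofReal (studentDensity d ν y)) ⋆ₗ[volume]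
        fun y => ENNReal.ofReal (studentDensity d μ y)) x := by
    rw [hconv]
    simp_rw [coeff_mul_phi_eq hd hν hμ, ← hK]
    have hC : 0 ≤ K * (1 + ‖x‖ ^ 2) ^ (-(ν + μ + (d : ℝ) / 2)) := by positivity
    simp_rw [ENNReal.ofReal_mul hC]
    rw [ENNReal.tsum_mul_left, tsum_ofReal_ascPochhammer_mul_betaMoment hp hq ha hz0 hz1,
      ← lintegral_const_mul' _ _ ENNReal.ofReal_ne_top]
    refine setLIntegral_congr_fun measurableSet_Ioo fun t ht => ?_
    have hq := one_sub_add_sq_mem ht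
    have hy : 0 ≤ 1 - ‖x‖ ^ 2 / (1 + ‖x‖ ^ 2) * (1 - t + t ^ 2) :=
      sub_nonneg.2 (mul_le_one₀ hz1 hq.1.le hq.2.le)
    rw [← ENNReal.ofReal_mul hC]
    congr 1
    rw [show 1 + ‖x‖ ^ 2 * (t * (1 - t)) =
        (1 + ‖x‖ ^ 2) * (1 - ‖x‖ ^ 2 / (1 + ‖x‖ ^ 2) * (1 - t + t ^ 2)) by field_simp; ring,
      mul_rpow hX.le hy]
    ring
  -- Bounding the power of `1 + ‖x‖² t(1-t)` by `1` leaves a beta integral. Finiteness at each `x`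
  -- gives summability everywhere rather than almost everywhere.
  have hfin : ((fun y => ENNReal.ofReal (studentDensity d ν y)) ⋆ₗ[volume]
        fun y => ENNReal.ofReal (studentDensity d μ y)) x ≠ ⊤ := by
    rw [hconv]
    refine ne_top_of_le_ne_top (b := ENNReal.ofReal K * ENNReal.ofReal
      (beta (μ + (d : ℝ) / 2) (ν + (d : ℝ) / 2))) (by finiteness) ?_
    rw [← lintegral_rpow_mul_one_sub_rpow hp hq, ← lintegral_const_mul' _ _ ENNReal.ofReal_ne_top]
    refine setLIntegral_mono' measurableSet_Ioo fun t ht => ?_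
    have ht0 := ht.1
    have ht1 := sub_pos.2 ht.2
    rw [← ENNReal.ofReal_mul hK0.le]
    refine ENNReal.ofReal_le_ofReal (mul_le_mul_of_nonneg_left ?_ hK0.le)
    refine mul_le_of_le_one_right (by positivity) ?_
    exact rpow_le_one_of_one_le_of_nonpos (by
      have : 0 ≤ ‖x‖ ^ 2 * (t * (1 - t)) := by positivity
      linarith) (by linarith)
  have hsum : Summable (fun n : ℕ => coeff d ν μ n * phi d n (ν + μ) x) :=
    (hasSum_of_tsum_ofReal_eq hnn ENNReal.toReal_nonneg
      (by rw [htsum, ENNReal.ofReal_toReal hfin])).summable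
  exact ⟨hsum, by rw [ENNReal.ofReal_tsum_of_nonneg hnn hsum, htsum]⟩

/-! ### The law of the sum, and Ruben's case. -/

lemma measurable_studentDensity (d : ℕ) (ν : ℝ) : Measurable (studentDensity d ν) := by
  unfold studentDensity
  fun_prop

lemma hasLaw_add_of_studentMeasure {Ω : Type*} [MeasurableSpace Ω] {P : Measure Ω}
    {d : ℕ} (hd : 1 ≤ d) {ν μ : ℝ} (hν : 0 < ν) (hμ : 0 < μ)
    {T₁ T₂ : Ω → EuclideanSpace ℝ (Fin d)} (hT₁ : HasLaw T₁ (studentMeasure d ν) P)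
    (hT₂ : HasLaw T₂ (studentMeasure d μ) P) (hindep : IndepFun T₁ T₂ P) :
    HasLaw (fun ω => T₁ ω + T₂ ω) (volume.withDensity fun x => ENNReal.ofReal
      (∑' n : ℕ, coeff d ν μ n * phi d n (ν + μ) x)) P := by
  have : ∀ η, SigmaFinite (studentMeasure d η) := fun η => SigmaFinite.withDensity_ofReal _
  have h := hindep.hasLaw_fun_add hT₁ hT₂
  rw [studentMeasure, studentMeasure, conv_withDensity_eq_lconvolution
    (measurable_studentDensity d ν).ennreal_ofReal
    (measurable_studentDensity d μ).ennreal_ofReal] at h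
  rwa [funext fun x => (summable_coeff_mul_phi_and_lconvolution_eq hd hν hμ x).2] at h

lemma coeff_mul_phi_one (ν : ℝ) (n : ℕ) (x : EuclideanSpace ℝ (Fin 1)) :
    (1 / beta ν ν * ((ascPochhammer ℝ n).eval (1 / 2 : ℝ) / (n ! : ℝ)) *
        ∫ t in (0 : ℝ)..1, (t * (1 - t)) ^ (ν - 1 / 2) * (1 - t + t ^ 2) ^ n) *
      (1 / beta (2 * ν) (n + 1 / 2) *
        (‖x‖ ^ (2 * n) / (1 + ‖x‖ ^ 2) ^ (2 * ν + n + 1 / 2))) =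
      coeff 1 ν ν n * phi 1 n (ν + ν) x := by
  have h1 : ∫ t in (0 : ℝ)..1, (t * (1 - t)) ^ (ν - 1 / 2) * (1 - t + t ^ 2) ^ n =
      ∫ t in (0 : ℝ)..1, t ^ (ν + ((1 : ℕ) : ℝ) / 2 - 1) * (1 - t) ^ (ν + ((1 : ℕ) : ℝ) / 2 - 1) *
        (1 - t + t ^ 2) ^ n := by
    refine intervalIntegral.integral_congr fun t ht => ?_
    rw [uIcc_of_le zero_le_one] at ht
    rw [mul_rpow ht.1 (sub_nonneg.2 ht.2), Nat.cast_one,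
      show ν + 1 / 2 - 1 = ν - 1 / 2 by ring]
  -- In dimension one `Γ(1/2) = √π` cancels the power of `π` in the constant of `phi`.
  have h2 : Gamma (1 / 2 : ℝ) / (π ^ (1 / 2 : ℝ) * beta (2 * ν) (n + 1 / 2)) =
      1 / beta (2 * ν) (n + 1 / 2) := by
    rw [Gamma_one_half_eq, ← sqrt_eq_rpow, ← div_div, div_self (sqrt_pos.2 pi_pos).ne']
  rw [h1, coeff, phi, Nat.cast_one, ← two_mul, h2]

end StudentSum

theorem mainTheorem1 {Ω : Type*} [MeasurableSpace Ω] (P : Measure Ω) [IsProbabilityMeasure P]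
    (d : ℕ) (hd : 1 ≤ d) (ν μ : ℝ) (hν : 0 < ν) (hμ : 0 < μ)
    (T₁ T₂ : Ω → EuclideanSpace ℝ (Fin d))
    (hT₁ : HasLaw T₁ (StudentSum.studentMeasure d ν) P)
    (hT₂ : HasLaw T₂ (StudentSum.studentMeasure d μ) P)
    (hindep : IndepFun T₁ T₂ P) :
    -- the coefficients are positive and sum to one
    (∀ n : ℕ, 0 < StudentSum.coeff d ν μ n) ∧
    HasSum (fun n : ℕ => StudentSum.coeff d ν μ n) 1 ∧
    -- the functions in the mixture are probability densities
    (∀ n : ℕ, Measurable (StudentSum.phi d n (ν + μ)) ∧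
      (∀ x, 0 ≤ StudentSum.phi d n (ν + μ) x) ∧
      ∫⁻ x, ENNReal.ofReal (StudentSum.phi d n (ν + μ) x) = 1) ∧
    -- the series converges at every point, and its sum is a density of the law of the sum
    (∀ x, Summable (fun n : ℕ => StudentSum.coeff d ν μ n * StudentSum.phi d n (ν + μ) x)) ∧
    HasLaw (fun ω => T₁ ω + T₂ ω)
      (volume.withDensity (fun x => ENNReal.ofReal
        (∑' n : ℕ, StudentSum.coeff d ν μ n * StudentSum.phi d n (ν + μ) x))) P ∧
    -- the special case of dimension one and equal degrees of freedom, written out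
    (d = 1 → μ = ν →
      (∀ x : EuclideanSpace ℝ (Fin d), Summable (fun n : ℕ =>
        (1 / beta ν ν * ((ascPochhammer ℝ n).eval (1 / 2 : ℝ) / (n ! : ℝ)) *
          ∫ t in (0 : ℝ)..1, (t * (1 - t)) ^ (ν - 1 / 2) * (1 - t + t ^ 2) ^ n) *
        (1 / beta (2 * ν) (n + 1 / 2) *
          (‖x‖ ^ (2 * n) / (1 + ‖x‖ ^ 2) ^ (2 * ν + n + 1 / 2))))) ∧
      HasLaw (fun ω => T₁ ω + T₂ ω)
        (volume.withDensity (fun x => ENNReal.ofReal (∑' n : ℕ,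
          (1 / beta ν ν * ((ascPochhammer ℝ n).eval (1 / 2 : ℝ) / (n ! : ℝ)) *
            ∫ t in (0 : ℝ)..1, (t * (1 - t)) ^ (ν - 1 / 2) * (1 - t + t ^ 2) ^ n) *
          (1 / beta (2 * ν) (n + 1 / 2) *
            (‖x‖ ^ (2 * n) / (1 + ‖x‖ ^ 2) ^ (2 * ν + n + 1 / 2)))))) P) := by
  refine ⟨StudentSum.coeff_pos hd hν hμ, StudentSum.hasSum_coeff hd hν hμ, fun n =>
    ⟨StudentSum.measurable_phi d n _, StudentSum.phi_nonneg hd n (add_pos hν hμ),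
      StudentSum.lintegral_phi hd n (add_pos hν hμ)⟩,
    fun x => (StudentSum.summable_coeff_mul_phi_and_lconvolution_eq hd hν hμ x).1,
    StudentSum.hasLaw_add_of_studentMeasure hd hν hμ hT₁ hT₂ hindep, ?_⟩
  rintro rfl rfl
  simp only [StudentSum.coeff_mul_phi_one]
  exact ⟨fun x => (StudentSum.summable_coeff_mul_phi_and_lconvolution_eq hd hν hμ x).1,
    StudentSum.hasLaw_add_of_studentMeasure hd hν hμ hT₁ hT₂ hindep⟩
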